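/- Let $\mathcal A$ be an AB5 abelian category (abelian, locally small, cocomplete, with exact filtered colimits) and let $Q$ be a (small) left-rooted quiver, i.e. a quiver with no infinite sequence of composable arrows $\cdots\to\bullet\to\bullet\to\bullet$. Let $\mathrm{Rep}(Q,\mathcal A)$ be the category of functors from the path category of $Q$ to $\mathcal A$. For a class $\mathcal X$ of objects of an abelian category (classes are understood up to isomorphism), let $\bigoplus\mathcal X$ be the class of all small (possibly empty) coproducts of objects of $\mathcal X$, let $\operatorname{Add}\mathcal X$ be the class of all direct summands of objects of $\bigoplus\mathcal X$, and let $\varinjlim\mathcal X$ be the class of all colimits of small filtered systems of objects of $\mathcal X$. For $\mathcal X\subseteq\mathcal A$ let $\Phi(\mathcal X)\subseteq\mathrm{Rep}(Q,\mathcal A)$ be the class of all $F$ such that for every vertex $v$ the canonical map $\bigoplus_{w\to v}F(w)\to F(v)$ (sum over all arrows with target $v$) is monic with cokernel in $\mathcal X$. For a vertex $v$ and $X\in\mathcal A$ let $f_v(X)$ be the representation $f_v(X)(w)=\bigoplus_{v\leadsto w}X$ (sum over all paths from $v$ to $w$), with arrows acting by the natural inclusions, and let $f_*(\mathcal X)=\{f_v(X)\mid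 v\in Q_0,\ X\in\mathcal X\}$. An object $X$ is finitely generated if $\varinjlim\operatorname{Hom}(X,Y_i)\to\operatorname{Hom}(X,\varinjlim Y_i)$ is injective for every small filtered system $(Y_i)$. Let $\operatorname{Proj}$ denote the class of projective objects and $\operatorname{proj}$ the class of finitely generated projective objects. 1. If $\mathcal X$ is any set (or class) of projective objects of $\mathcal A$, then $\Phi(\bigoplus\mathcal X)=\bigoplus f_*(\mathcal X)\supseteq\bigoplus\Phi(\mathcal X)$, and if moreover $0\in\mathcal X$, then also $\Phi(\bigoplus\mathcal X)=\bigoplus\Phi(\mathcal X)$. 2. If $\mathcal X$ is any set (or class) of projective objects of $\mathcal A$, then $\Phi(\operatorname{Add}\mathcal X)=\operatorname{Add}f_*(\mathcal X)=\operatorname{Add}\Phi(\mathcal X)$. 3. If $\mathcal A$ has enough projectives, then $\Phi(\operatorname{Proj}\mathcal A)=\operatorname{Proj}(\mathrm{Rep}(Q,\mathcal A))$. 4. If $\mathcal A$ is locally finitely presented and $\operatorname{proj}(\mathcal A)$ generates $\mathcal A$ (a morphism $f$ out of $X$ is zero as soon as $fg=0$ for all $g\colon P\to X$ with $P\in\operatorname{proj}(\mathcal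 A)$), then $\Phi(\varinjlim\operatorname{proj}(\mathcal A))=\varinjlim\operatorname{proj}(\mathrm{Rep}(Q,\mathcal A))$. -/

import Mathlib

open CategoryTheory CategoryTheory.Limits

universe v u

namespace QuiverRep

/-- A quiver is left-rooted if it has no infinite sequence of composable arrows
`⋯ ⟶ x 2 ⟶ x 1 ⟶ x 0`. -/
def IsLeftRooted (Q : Type v) [Quiver.{v} Q] : Prop :=
  ¬ ∃ x : ℕ → Q, ∀ n, Nonempty (x (n + 1) ⟶ x n)

section Classes

variable {C : Type u} [Category.{v} C]

/-- `⨁ X`: the class of all objects which are a small (possibly empty or infinite) coproduct of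
objects of `X`. -/
def sums (X : ObjectProperty C) : ObjectProperty C :=
  fun Y => ∃ J : Type v, X.colimitsOfShape (Discrete J) Y

/-- `Add X`: the class of all direct summands (that is, retracts) of small coproducts of objects
of `X`. -/
def addClosure (X : ObjectProperty C) : ObjectProperty C :=
  (sums X).retractClosure

/-- `X` is finitely generated: for each small filtered system `F` with colimit `c`, the canonical map
`colim Hom(X, F j) → Hom(X, colim F)` is injective. As the system is filtered, two elements of the
left side are represented at a common index `j`, and they are equal there exactly if their
representatives agree after some transition map `j ⟶ k`. -/
def IsFinitelyGenerated (X : C) : Prop :=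
  ∀ (J : Type v) [SmallCategory J] [IsFiltered J] (F : J ⥤ C) (c : Cocone F) (_ : IsColimit c)
    (j : J) (f g : X ⟶ F.obj j), f ≫ c.ι.app j = g ≫ c.ι.app j →
      ∃ (k : J) (t : j ⟶ k), f ≫ F.map t = g ≫ F.map t

variable (C) in
/-- `proj C`: the finitely generated projective objects. -/
def fgProj : ObjectProperty C :=
  fun X => IsFinitelyGenerated X ∧ Projective X

end Classes

/-- The category `Rep(Q, A)` of representations of `Q` in `A`: functors from the path category. -/
abbrev Rep (Q : Type v) [Quiver.{v} Q] (A : Type u) [Category.{v} A] :=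
  Paths Q ⥤ A

variable {Q : Type v} [Quiver.{v} Q] {A : Type u} [Category.{v} A]

/-- The value of a representation at a vertex. -/
abbrev Rep.at (F : Rep Q A) (w : Q) : A := F.obj ((Paths.of Q).obj w)

section

variable [HasCoproducts.{v} A]

/-- The representation `f_v(X)`, given by `f_v(X)(w) = ⨁_{p : v ⇝ w} X`, the sum over all paths
from `v` to `w`; a path `q : w ⇝ w'` maps the summand at `p` identically to the summand at the
composite path `p` followed by `q`. -/
noncomputable def freeRep (v : Q) (X : A) : Rep Q A where
  obj w := ∐ fun _ : ((Paths.of Q).obj v ⟶ w) => X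
  map q := Sigma.desc fun p => Sigma.ι (fun _ => X) (p ≫ q)
  map_id w := by
    apply Sigma.hom_ext
    intro p
    simp
  map_comp q r := by
    apply Sigma.hom_ext
    intro p
    simp

/-- The class `f_*(X)` of all representations `f_v(x)`, with `v` a vertex and `x` in `X`. -/
def freeReps (Q : Type v) [Quiver.{v} Q] (X : ObjectProperty A) : ObjectProperty (Rep Q A) :=
  fun F => ∃ (v : Q) (x : A), X x ∧ Nonempty (F ≅ freeRep v x)

/-- The canonical map `φ_v^F : ⨁_{a : w ⟶ v} F(w) ⟶ F(v)`, the sum over all arrows with target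
`v`. -/
noncomputable def phiMap (F : Rep Q A) (v : Q) :
    (∐ fun a : (Σ w : Q, (w ⟶ v)) => F.at a.1) ⟶ F.at v :=
  Sigma.desc fun a => F.map ((Paths.of Q).map a.2)

end

/-- The class `Φ(X)`: representations `F` such that, for each vertex `v`, the map `φ_v^F` is monic
and its cokernel is (isomorphic to an object) in `X`. -/
def Phi (Q : Type v) [Quiver.{v} Q] [Abelian A] [HasCoproducts.{v} A] (X : ObjectProperty A) :
    ObjectProperty (Rep Q A) :=
  fun F => ∀ v : Q, Mono (phiMap F v) ∧ X.isoClosure (cokernel (phiMap F v))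

end QuiverRep

/-! Everything rests on three facts. First, `phi` is natural, and both its source and its cokernel
commute with colimits in the representation; by exactness of coproducts (AB4) and filtered colimits
(AB5), monicity of `phi` passes to such colimits. Second, `freeRep v X` has split monic `phi`, with
cokernel `X` at `v` and zero elsewhere. Third, left-rootedness allows induction along arrows: if all
maps `phi` are monic, a morphism that is iso on all cokernels is iso
(`isIso_of_isIso_phiCoker_map`).

If the cokernels of `F` are projective, sections of the projections onto them assemble into a
morphism from the coproduct of the `freeRep w (coker at w)` to `F` that is iso on cokernels, hence
iso (`nonempty_iso_sigma_freeRep`). Statements 1–3 follow by closure arguments.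

For statement 4, a finitely generated projective representation decomposes as above, which makes its
cokernels finitely generated projective; a filtered colimit then finishes one inclusion. The other
uses Lazard's criterion: every morphism `M ⟶ F` from a finitely presentable `M` must factor through
a finitely generated projective (`exists_factorization`). Here `F` is filtered by its
subrepresentations generated by predecessor-closed vertex sets. Zorn's lemma enlarges such a set one
vertex at a time, each successive layer being `freeRep w` of the cokernel at `w`, and finite
presentability of `M` handles unions. -/

namespace QuiverRep

/-! ### The map `phi`, its source and its cokernel as functors of the representation -/

section PhiFunctors

variable {Q : Type v} [Quiver.{v} Q] {A : Type u} [Category.{v} A]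

variable (A) in
/-- Evaluation of representations at a vertex. -/
abbrev evalAt (w : Q) : Rep Q A ⥤ A := (evaluation (Paths Q) A).obj ((Paths.of Q).obj w)

section Source

variable [HasCoproducts.{v} A]

variable (A) in
/-- The functor sending a representation `F` to `⨁_{a : u ⟶ w} F(u)`. -/
noncomputable def phiSource (w : Q) : Rep Q A ⥤ A where
  obj F := ∐ fun a : (Σ u : Q, (u ⟶ w)) => F.at a.1
  map α := Limits.Sigma.map fun a => α.app ((Paths.of Q).obj a.1)

/-- The inclusion of the summand of `phiSource` indexed by an arrow. -/
noncomputable def sourceι (F : Rep Q A) {w : Q} (a : Σ u : Q, (u ⟶ w)) :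
    F.at a.1 ⟶ (phiSource A w).obj F :=
  Sigma.ι (fun a : (Σ u : Q, (u ⟶ w)) => F.at a.1) a

/-- The morphism out of `phiSource` given by morphisms on all summands. -/
noncomputable def sourceDesc (F : Rep Q A) {w : Q} {Z : A}
    (f : ∀ a : (Σ u : Q, (u ⟶ w)), F.at a.1 ⟶ Z) : (phiSource A w).obj F ⟶ Z :=
  Sigma.desc f

@[simp]
lemma sourceι_desc (F : Rep Q A) {w : Q} {Z : A}
    (f : ∀ a : (Σ u : Q, (u ⟶ w)), F.at a.1 ⟶ Z) (a : Σ u : Q, (u ⟶ w)) :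
    sourceι F a ≫ sourceDesc F f = f a :=
  Sigma.ι_desc _ _

@[simp]
lemma sourceι_map {F G : Rep Q A} (α : F ⟶ G) {w : Q} (a : Σ u : Q, (u ⟶ w)) :
    sourceι F a ≫ (phiSource A w).map α =
      α.app ((Paths.of Q).obj a.1) ≫ sourceι G a :=
  Sigma.ι_map (fun a : (Σ u : Q, (u ⟶ w)) => α.app ((Paths.of Q).obj a.1)) a

@[simp]
lemma sourceι_map_assoc {F G : Rep Q A} (α : F ⟶ G) {w : Q} (a : Σ u : Q, (u ⟶ w)) {Z : A}
    (h : (phiSource A w).obj G ⟶ Z) :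
    sourceι F a ≫ (phiSource A w).map α ≫ h =
      α.app ((Paths.of Q).obj a.1) ≫ sourceι G a ≫ h := by
  rw [← Category.assoc, sourceι_map, Category.assoc]

lemma source_hom_ext {F : Rep Q A} {w : Q} {Z : A} {f g : (phiSource A w).obj F ⟶ Z}
    (h : ∀ a : (Σ u : Q, (u ⟶ w)), sourceι F a ≫ f = sourceι F a ≫ g) : f = g :=
  Sigma.hom_ext _ _ h

/-- The map `phiMap`, with source the value of the functor `phiSource`. -/
noncomputable def phi (F : Rep Q A) (w : Q) : (phiSource A w).obj F ⟶ F.at w := phiMap F w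

@[simp]
lemma sourceι_phi (F : Rep Q A) {w : Q} (a : Σ u : Q, (u ⟶ w)) :
    sourceι F a ≫ phi F w = F.map ((Paths.of Q).map a.2) :=
  Sigma.ι_desc _ _

@[simp]
lemma sourceι_phi_assoc (F : Rep Q A) {w : Q} (a : Σ u : Q, (u ⟶ w)) {Z : A}
    (h : F.at w ⟶ Z) :
    sourceι F a ≫ phi F w ≫ h = F.map ((Paths.of Q).map a.2) ≫ h := by
  rw [← Category.assoc, sourceι_phi]

lemma phi_naturality {F G : Rep Q A} (α : F ⟶ G) (w : Q) :
    (phiSource A w).map α ≫ phi G w = phi F w ≫ α.app ((Paths.of Q).obj w) := by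
  refine source_hom_ext fun a => ?_
  rw [sourceι_map_assoc, sourceι_phi, sourceι_phi_assoc, α.naturality]

variable (A) in
/-- The maps `phi` form a natural transformation. -/
noncomputable def phiNat (w : Q) : phiSource A w ⟶ evalAt A w where
  app F := phi F w
  naturality _ _ α := phi_naturality α w

/-- Colimits of representations are computed vertexwise and commute with coproducts, so descent is
done one summand at a time. -/
instance {J : Type*} [Category* J] [HasColimitsOfShape J A] (w : Q) :
    PreservesColimitsOfShape J (phiSource A w) where
  preservesColimit {D} := ⟨fun {c} hc => ⟨by
    have hev (u : Q) := isColimitOfPreserves (evalAt A u) hc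
    let cc (s : Cocone (D ⋙ phiSource A w)) (a : Σ u : Q, (u ⟶ w)) :
        Cocone (D ⋙ evalAt A a.1) :=
      { pt := s.pt
        ι :=
          { app j := sourceι (D.obj j) a ≫ s.ι.app j
            naturality i j f := by
              have := s.w f
              dsimp at this ⊢
              rw [← this, sourceι_map_assoc, Category.comp_id] } }
    refine
      { desc s := sourceDesc c.pt fun a => (hev a.1).desc (cc s a)
        fac s j := ?_
        uniq s m hm := ?_ }
    · refine source_hom_ext fun a => ?_
      dsimp
      rw [sourceι_map_assoc, sourceι_desc]
      exact (hev a.1).fac (cc s a) j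
    · refine source_hom_ext fun a => (hev a.1).hom_ext fun j => ?_
      have := hm j
      dsimp at this m ⊢
      rw [← sourceι_map_assoc, this, sourceι_desc]
      exact ((hev a.1).fac (cc s a) j).symm⟩⟩

lemma mono_phi_of_isColimit {J : Type*} [Category* J] [HasColimitsOfShape J A]
    [(MorphismProperty.monomorphisms A).IsStableUnderColimitsOfShape J]
    {D : J ⥤ Rep Q A} {c : Cocone D} (hc : IsColimit c) (w : Q)
    (h : ∀ j, Mono (phi (D.obj j) w)) : Mono (phi c.pt w) :=
  MorphismProperty.IsStableUnderColimitsOfShape.condition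
    (W := MorphismProperty.monomorphisms A) (D ⋙ phiSource A w) (D ⋙ evalAt A w) _ _
    (isColimitOfPreserves (phiSource A w) hc) (isColimitOfPreserves (evalAt A w) hc)
    (D.whiskerLeft (phiNat A w)) h (phi c.pt w)
    (fun j => (phi_naturality (c.ι.app j) w))

lemma mono_phi_of_retract {F G : Rep Q A} (r : Retract F G) (w : Q) [Mono (phi G w)] :
    Mono (phi F w) := by
  have : IsSplitMono ((phiSource A w).map r.i) :=
    ⟨⟨(r.map (phiSource A w)).r, (r.map (phiSource A w)).retract⟩⟩
  have : Mono (phi F w ≫ r.i.app ((Paths.of Q).obj w)) := by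
    rw [← phi_naturality]
    infer_instance
  exact mono_of_mono _ (r.i.app ((Paths.of Q).obj w))

end Source

section Coker

variable [Abelian A] [HasCoproducts.{v} A]

variable (A) in
/-- The functor sending a representation to the cokernel of `phi` at a vertex. -/
noncomputable def phiCoker (w : Q) : Rep Q A ⥤ A where
  obj F := cokernel (phi F w)
  map {F G} α := cokernel.map _ _ ((phiSource A w).map α) (α.app ((Paths.of Q).obj w))
    (phi_naturality α w).symm
  map_id F := coequalizer.hom_ext (by simp)
  map_comp α β := coequalizer.hom_ext (by simp)

/-- The projection onto `phiCoker`. -/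
noncomputable def phiπ (F : Rep Q A) (w : Q) : F.at w ⟶ (phiCoker A w).obj F :=
  cokernel.π (phi F w)

instance (F : Rep Q A) (w : Q) : Epi (phiπ F w) := inferInstanceAs (Epi (cokernel.π _))

@[simp]
lemma phi_phiπ (F : Rep Q A) (w : Q) : phi F w ≫ phiπ F w = 0 := cokernel.condition _

@[simp]
lemma phi_phiπ_assoc (F : Rep Q A) (w : Q) {Z : A} (h : (phiCoker A w).obj F ⟶ Z) :
    phi F w ≫ phiπ F w ≫ h = 0 := by
  rw [← Category.assoc, phi_phiπ, zero_comp]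

@[simp]
lemma map_phiπ (F : Rep Q A) {u w : Q} (a : u ⟶ w) :
    F.map ((Paths.of Q).map a) ≫ phiπ F w = 0 := by
  rw [← sourceι_phi F ⟨u, a⟩, Category.assoc, phi_phiπ, comp_zero]

@[simp]
lemma phiπ_naturality {F G : Rep Q A} (α : F ⟶ G) (w : Q) :
    phiπ F w ≫ (phiCoker A w).map α = α.app ((Paths.of Q).obj w) ≫ phiπ G w := by
  simp [phiCoker, phiπ]

@[simp]
lemma phiπ_naturality_assoc {F G : Rep Q A} (α : F ⟶ G) (w : Q) {Z : A}
    (h : (phiCoker A w).obj G ⟶ Z) :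
    phiπ F w ≫ (phiCoker A w).map α ≫ h = α.app ((Paths.of Q).obj w) ≫ phiπ G w ≫ h := by
  rw [← Category.assoc, phiπ_naturality, Category.assoc]

/-- Morphisms out of `phiCoker`. -/
noncomputable def phiDesc (F : Rep Q A) {w : Q} {Z : A} (f : F.at w ⟶ Z)
    (h : phi F w ≫ f = 0) : (phiCoker A w).obj F ⟶ Z :=
  cokernel.desc _ f h

@[simp]
lemma phiπ_phiDesc (F : Rep Q A) {w : Q} {Z : A} (f : F.at w ⟶ Z)
    (h : phi F w ≫ f = 0) : phiπ F w ≫ phiDesc F f h = f :=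
  cokernel.π_desc _ _ _

@[simp]
lemma phiπ_phiDesc_assoc (F : Rep Q A) {w : Q} {Z Z' : A} (f : F.at w ⟶ Z)
    (h : phi F w ≫ f = 0) (g : Z ⟶ Z') : phiπ F w ≫ phiDesc F f h ≫ g = f ≫ g := by
  rw [← Category.assoc, phiπ_phiDesc]

lemma isIso_phiπ (F : Rep Q A) (w : Q) (h : phi F w = 0) : IsIso (phiπ F w) := by
  have : phiDesc F (𝟙 _) (by simp [h]) ≫ phiπ F w = 𝟙 _ := by
    simp [← cancel_epi (phiπ F w)]
  exact ⟨⟨phiDesc F (𝟙 _) (by simp [h]), by simp, this⟩⟩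

lemma phi_exact (F : Rep Q A) (w : Q) :
    (ShortComplex.mk (phi F w) (phiπ F w) (by simp)).Exact :=
  ShortComplex.exact_cokernel _

/-- A cokernel is a colimit, and evaluation and `phiSource` preserve colimits. -/
instance {J : Type*} [Category* J] [HasColimitsOfShape J A] (w : Q) :
    PreservesColimitsOfShape J (phiCoker A w) where
  preservesColimit {D} := ⟨fun {c} hc => ⟨by
    have hev := isColimitOfPreserves (evalAt A w) hc
    have hs := isColimitOfPreserves (phiSource A w) hc
    let cc (s : Cocone (D ⋙ phiCoker A w)) : Cocone (D ⋙ evalAt A w) :=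
      { pt := s.pt
        ι :=
          { app j := phiπ (D.obj j) w ≫ s.ι.app j
            naturality i j f := by
              have := s.w f
              dsimp at this ⊢
              rw [← this, phiπ_naturality_assoc, Category.comp_id] } }
    refine
      { desc s := phiDesc _ (hev.desc (cc s)) (hs.hom_ext fun j => ?_)
        fac s j := ?_
        uniq s m hm := ?_ }
    · have h1 := phi_naturality (c.ι.app j) w
      have h2 := hev.fac (cc s) j
      dsimp at h1 h2 ⊢
      rw [reassoc_of% h1, h2, phi_phiπ_assoc, comp_zero]
    · rw [← cancel_epi (phiπ (D.obj j) w)]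
      have h2 := hev.fac (cc s) j
      dsimp at h2 ⊢
      rw [phiπ_naturality_assoc, phiπ_phiDesc, h2]
    · rw [← cancel_epi (phiπ _ w), phiπ_phiDesc]
      refine hev.hom_ext fun j => ?_
      have h1 := hm j
      have h2 := hev.fac (cc s) j
      dsimp at h1 h2 m ⊢
      rw [h2, ← phiπ_naturality_assoc, h1]⟩⟩

end Coker

end PhiFunctors

/-! ### Free representations and their cokernels -/

section FreeRep

variable {Q : Type v} [Quiver.{v} Q] {A : Type u} [Category.{v} A] [HasCoproducts.{v} A]

variable (A) in
/-- The functor sending `X` to `freeRep v X`. -/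
noncomputable def freeFunctor (v : Q) : A ⥤ Rep Q A :=
  evaluationLeftAdjoint A ((Paths.of Q).obj v)

variable (A) in
/-- The functor `freeFunctor v` is left adjoint to the evaluation at `v`. -/
noncomputable def freeAdjunction (v : Q) : freeFunctor A v ⊣ evalAt A v :=
  evaluationAdjunctionRight A ((Paths.of Q).obj v)

/-- The inclusion of the summand of `freeRep v X` indexed by a path. -/
noncomputable def freeι (v : Q) (X : A) {w : Q} (p : Quiver.Path v w) :
    X ⟶ (freeRep v X).at w :=
  Sigma.ι (fun _ : ((Paths.of Q).obj v ⟶ (Paths.of Q).obj w) => X) p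

/-- The morphism out of the value of `freeRep v X` at a vertex given by its components. -/
noncomputable def freeAtDesc (v : Q) {X Z : A} {w : Q} (f : Quiver.Path v w → (X ⟶ Z)) :
    (freeRep v X).at w ⟶ Z :=
  Sigma.desc f

@[simp]
lemma freeι_desc {v : Q} {X Z : A} {w : Q} (f : Quiver.Path v w → (X ⟶ Z))
    (p : Quiver.Path v w) : freeι v X p ≫ freeAtDesc v f = f p :=
  Sigma.ι_desc _ _

@[simp]
lemma freeι_map {v : Q} {X : A} {w w' : Q} (p : Quiver.Path v w) (a : w ⟶ w') :
    freeι v X p ≫ (freeRep v X).map ((Paths.of Q).map a) = freeι v X (p.cons a) :=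
  Sigma.ι_desc _ _

lemma free_hom_ext {v : Q} {X Z : A} {w : Q} {f g : (freeRep v X).at w ⟶ Z}
    (h : ∀ p : Quiver.Path v w, freeι v X p ≫ f = freeι v X p ≫ g) : f = g :=
  Sigma.hom_ext _ _ h

lemma freeAdjunction_homEquiv {v : Q} {X : A} {F : Rep Q A} (α : freeRep v X ⟶ F) :
    (freeAdjunction A v).homEquiv X F α = freeι v X .nil ≫ α.app ((Paths.of Q).obj v) := by
  have : (freeAdjunction A v).unit.app X = freeι v X .nil := by
    refine (evaluationAdjunctionRight_unit_app (D := A) ((Paths.of Q).obj v) X).trans ?_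
    rfl
  refine ((freeAdjunction A v).homEquiv_unit (f := α)).trans ?_
  exact congrArg (· ≫ α.app ((Paths.of Q).obj v)) this

/-- The morphism `freeRep v X ⟶ F` corresponding to `X ⟶ F.at v`. -/
noncomputable def freeDesc {v : Q} {X : A} {F : Rep Q A} (s : X ⟶ F.at v) :
    freeRep v X ⟶ F :=
  ((freeAdjunction A v).homEquiv X F).symm s

@[simp]
lemma freeι_nil_freeDesc {v : Q} {X : A} {F : Rep Q A} (s : X ⟶ F.at v) :
    freeι v X .nil ≫ (freeDesc s).app ((Paths.of Q).obj v) = s :=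
  (freeAdjunction_homEquiv _).symm.trans (((freeAdjunction A v).homEquiv X F).apply_symm_apply s)

@[simp]
lemma freeι_nil_freeDesc_assoc {v : Q} {X : A} {F : Rep Q A} (s : X ⟶ F.at v) {Z : A}
    (h : F.at v ⟶ Z) :
    freeι v X .nil ≫ (freeDesc s).app ((Paths.of Q).obj v) ≫ h = s ≫ h := by
  rw [← Category.assoc, freeι_nil_freeDesc]

lemma freeDesc_comp {v : Q} {X : A} {F G : Rep Q A} (s : X ⟶ F.at v) (α : F ⟶ G) :
    freeDesc s ≫ α = freeDesc (s ≫ α.app ((Paths.of Q).obj v)) :=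
  ((freeAdjunction A v).homEquiv_naturality_right_symm s α).symm

lemma freeRep_hom_ext {v : Q} {X : A} {F : Rep Q A} {α β : freeRep v X ⟶ F}
    (h : freeι v X .nil ≫ α.app ((Paths.of Q).obj v) =
      freeι v X .nil ≫ β.app ((Paths.of Q).obj v)) : α = β :=
  ((freeAdjunction A v).homEquiv X F).injective <|
    (freeAdjunction_homEquiv α).trans (h.trans (freeAdjunction_homEquiv β).symm)

section Zero

variable [HasZeroMorphisms A]

/-- The components of the retraction `phiRetraction`. -/
noncomputable def phiRetractionAux (v : Q) (X : A) :
    ∀ {w : Q}, Quiver.Path v w → (X ⟶ (phiSource A w).obj (freeRep v X))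
  | _, .nil => 0
  | _, .cons p a => freeι v X p ≫ sourceι (freeRep v X) ⟨_, a⟩

/-- A retraction of `phi (freeRep v X) w`. -/
noncomputable def phiRetraction (v : Q) (X : A) (w : Q) :
    (freeRep v X).at w ⟶ (phiSource A w).obj (freeRep v X) :=
  freeAtDesc v (phiRetractionAux v X)

/-- A nontrivial path has a unique last arrow, so `phi` is the inclusion of the summands indexed by
nontrivial paths. -/
lemma phi_phiRetraction (v : Q) (X : A) (w : Q) :
    phi (freeRep v X) w ≫ phiRetraction v X w = 𝟙 _ := by
  refine source_hom_ext fun ⟨u, a⟩ => free_hom_ext fun p => ?_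
  rw [sourceι_phi_assoc, ← Category.assoc, freeι_map, phiRetraction, freeι_desc,
    phiRetractionAux, Category.comp_id]

instance mono_phi_freeRep (v : Q) (X : A) (w : Q) : Mono (phi (freeRep v X) w) :=
  have : IsSplitMono (phi (freeRep v X) w) := ⟨⟨⟨_, phi_phiRetraction v X w⟩⟩⟩
  inferInstance

end Zero

variable [Abelian A]

lemma freeι_cons_phiπ {v : Q} {X : A} {u w : Q} (p : Quiver.Path v u) (a : u ⟶ w) :
    freeι v X (p.cons a) ≫ phiπ (freeRep v X) w = 0 := by
  rw [← freeι_map, Category.assoc, map_phiπ, comp_zero]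

lemma isZero_phiCoker_freeRep {v w : Q} (h : v ≠ w) (X : A) :
    IsZero ((phiCoker A w).obj (freeRep v X)) := by
  rw [IsZero.iff_id_eq_zero, ← cancel_epi (phiπ _ w)]
  refine free_hom_ext fun p => ?_
  cases p with
  | nil => exact (h rfl).elim
  | cons p a =>
    rw [← Category.assoc, freeι_cons_phiπ, zero_comp, comp_zero, comp_zero]

/-- The cokernel of `phi (freeRep v X) v` is `X`. -/
@[simps inv]
noncomputable def phiCokerFreeRepIso (v : Q) (X : A) :
    (phiCoker A v).obj (freeRep v X) ≅ X where
  -- Summands at nontrivial paths, including cycles at `v`, lie in the image of `phi`; only the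
  -- trivial path survives in the cokernel.
  hom := phiDesc _ (freeAtDesc v fun p => if p.length = 0 then 𝟙 X else 0) (by
    refine source_hom_ext fun ⟨u, a⟩ => free_hom_ext fun p => ?_
    rw [sourceι_phi_assoc, ← Category.assoc, freeι_map, freeι_desc]
    simp)
  inv := freeι v X .nil ≫ phiπ (freeRep v X) v
  hom_inv_id := by
    rw [← cancel_epi (phiπ _ v)]
    refine free_hom_ext fun p => ?_
    rw [phiπ_phiDesc_assoc, ← Category.assoc, freeι_desc, Category.comp_id]
    cases p with
    | nil => simp
    | cons p a => simp [freeι_cons_phiπ]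
  inv_hom_id := by
    rw [Category.assoc, phiπ_phiDesc, freeι_desc]
    simp

lemma phiCokerFreeRepIso_inv_map {v : Q} {X : A} {F : Rep Q A} (s : X ⟶ F.at v) :
    (phiCokerFreeRepIso v X).inv ≫ (phiCoker A v).map (freeDesc s) = s ≫ phiπ F v := by
  simp

end FreeRep

/-! ### Induction along arrows -/

section Rooted

variable {Q : Type v} [Quiver.{v} Q] {A : Type u} [Category.{v} A] [HasCoproducts.{v} A]

lemma IsLeftRooted.wellFounded (hQ : IsLeftRooted Q) :
    WellFounded fun u w : Q => Nonempty (u ⟶ w) := by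
  rw [wellFounded_iff_isEmpty_descending_chain]
  exact ⟨fun ⟨x, hx⟩ => hQ ⟨x, hx⟩⟩

lemma isIso_phiSource_map {F G : Rep Q A} (α : F ⟶ G) {w : Q}
    (h : ∀ u : Q, Nonempty (u ⟶ w) → IsIso (α.app ((Paths.of Q).obj u))) :
    IsIso ((phiSource A w).map α) := by
  have (a : Σ u : Q, (u ⟶ w)) : IsIso (α.app ((Paths.of Q).obj a.1)) := h _ ⟨a.2⟩
  exact inferInstanceAs (IsIso (Limits.Sigma.map
    fun a : (Σ u : Q, (u ⟶ w)) => α.app ((Paths.of Q).obj a.1)))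

lemma mono_phiSource_map [AB4OfSize.{v} A] [Abelian A] {F G : Rep Q A} (α : F ⟶ G) {w : Q}
    (h : ∀ u : Q, Nonempty (u ⟶ w) → Mono (α.app ((Paths.of Q).obj u))) :
    Mono ((phiSource A w).map α) := by
  refine MorphismProperty.colimMap (W := MorphismProperty.monomorphisms A) _ fun a => ?_
  exact h _ ⟨a.as.2⟩

variable [Abelian A]

/-- The sequence `phiSource F ⟶ F.at w ⟶ phiCoker F`. -/
noncomputable def phiComplex (F : Rep Q A) (w : Q) : ShortComplex A :=
  ShortComplex.mk (phi F w) (phiπ F w) (phi_phiπ F w)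

/-- The functoriality of `phiComplex`. -/
noncomputable def phiComplexMap {F G : Rep Q A} (α : F ⟶ G) (w : Q) :
    phiComplex F w ⟶ phiComplex G w where
  τ₁ := (phiSource A w).map α
  τ₂ := α.app ((Paths.of Q).obj w)
  τ₃ := (phiCoker A w).map α
  comm₁₂ := phi_naturality α w
  comm₂₃ := (phiπ_naturality α w).symm

lemma phiComplex_exact (F : Rep Q A) (w : Q) : (phiComplex F w).Exact :=
  phi_exact F w

lemma phiComplex_shortExact (F : Rep Q A) (w : Q) [hF : Mono (phi F w)] :
    (phiComplex F w).ShortExact where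
  exact := phiComplex_exact F w
  mono_f := hF
  epi_g := inferInstanceAs (Epi (phiπ F w))

/-- By induction the morphism is iso at all predecessors of `w`, hence on `phiSource`; the short
five lemma then gives `w`. -/
lemma isIso_of_isIso_phiCoker_map (hQ : IsLeftRooted Q) {F G : Rep Q A} (α : F ⟶ G)
    (hF : ∀ w, Mono (phi F w)) (hG : ∀ w, Mono (phi G w))
    (h : ∀ w, IsIso ((phiCoker A w).map α)) : IsIso α := by
  suffices ∀ w : Q, IsIso (α.app ((Paths.of Q).obj w)) from
    (NatTrans.isIso_iff_isIso_app α).2 this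
  intro w
  induction w using hQ.wellFounded.induction with
  | _ w ih =>
    have : IsIso (phiComplexMap α w).τ₁ := isIso_phiSource_map α ih
    have : IsIso (phiComplexMap α w).τ₃ := h w
    exact ShortComplex.isIso₂_of_shortExact_of_isIso₁₃ (phiComplexMap α w)
      (phiComplex_shortExact F w) (phiComplex_shortExact G w)

lemma mono_of_mono_phiCoker_map [AB4OfSize.{v} A] (hQ : IsLeftRooted Q) {F G : Rep Q A}
    (α : F ⟶ G) (hF : ∀ w, Mono (phi F w)) (hG : ∀ w, Mono (phi G w))
    (h : ∀ w, Mono ((phiCoker A w).map α)) : Mono α := by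
  suffices ∀ w : Q, Mono (α.app ((Paths.of Q).obj w)) from
    have (w : Paths Q) : Mono (α.app w) := this w
    NatTrans.mono_of_mono_app α
  intro w
  induction w using hQ.wellFounded.induction with
  | _ w ih =>
    have : Mono (phiComplexMap α w).τ₁ := mono_phiSource_map α ih
    have : Mono (phiComplexMap α w).τ₃ := h w
    have : Mono (phiComplex F w).f := hF w
    have : Mono (phiComplex G w).f := hG w
    exact ShortComplex.mono_τ₂_of_exact_of_mono (phiComplexMap α w) (phiComplex_exact F w)

end Rooted

/-! ### Closure under coproducts and direct summands -/

section Sums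

variable {C : Type u} [Category.{v} C]

instance (X : ObjectProperty C) : (sums X).IsClosedUnderIsomorphisms where
  of_iso e := fun ⟨J, ⟨p⟩⟩ => ⟨J, ⟨p.ofIso e⟩⟩

instance (X : ObjectProperty C) : (addClosure X).IsStableUnderRetracts :=
  inferInstanceAs (sums X).retractClosure.IsStableUnderRetracts

variable [HasCoproducts.{v} C]

lemma sums_iff {X : ObjectProperty C} {Y : C} :
    sums X Y ↔ ∃ (J : Type v) (f : J → C), (∀ j, X (f j)) ∧ Nonempty (Y ≅ ∐ f) := by
  constructor
  · rintro ⟨J, ⟨p⟩⟩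
    exact ⟨J, fun j => p.diag.obj ⟨j⟩, fun j => p.prop_diag_obj _,
      ⟨p.isColimit.coconePointsIsoOfNatIso (colimit.isColimit _) Discrete.natIsoFunctor⟩⟩
  · rintro ⟨J, f, hf, ⟨e⟩⟩
    exact ⟨J, ⟨(ObjectProperty.ColimitOfShape.colimit (Discrete.functor f)
      fun j => hf j.as).ofIso e.symm⟩⟩

lemma sums_sigma {X : ObjectProperty C} {J : Type v} (f : J → C) (hf : ∀ j, X (f j)) :
    sums X (∐ f) :=
  sums_iff.2 ⟨J, f, hf, ⟨Iso.refl _⟩⟩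

lemma le_sums (X : ObjectProperty C) : X ≤ sums X := fun Y hY =>
  sums_iff.2 ⟨PUnit, fun _ => Y, fun _ => hY, ⟨(coproductUniqueIso fun _ => Y).symm⟩⟩

lemma sums_isZero [HasZeroMorphisms C] (X : ObjectProperty C) {Y : C} (hY : IsZero Y) : sums X Y :=
  sums_iff.2 ⟨PEmpty, PEmpty.elim, fun j => j.elim,
    ⟨hY.iso ((IsZero.iff_id_eq_zero _).2 (Sigma.hom_ext _ _ fun j => j.elim))⟩⟩

lemma sums_le_of_closed {X Y : ObjectProperty C} [Y.IsClosedUnderIsomorphisms] (h : X ≤ Y)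
    (hY : ∀ (J : Type v) (f : J → C), (∀ j, Y (f j)) → Y (∐ f)) : sums X ≤ Y := by
  intro Z hZ
  obtain ⟨J, f, hf, ⟨e⟩⟩ := sums_iff.1 hZ
  exact Y.prop_of_iso e.symm (hY J f fun j => h _ (hf j))

lemma sums_sigma_of_sums {X : ObjectProperty C} {J : Type v} (f : J → C)
    (hf : ∀ j, sums X (f j)) : sums X (∐ f) := by
  choose K g hg e using fun j => sums_iff.1 (hf j)
  exact sums_iff.2 ⟨Σ j, K j, fun p => g p.1 p.2, fun p => hg _ _,
    ⟨Sigma.mapIso (fun j => (e j).some) ≪≫ sigmaSigmaIso K fun j => g j⟩⟩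

lemma sums_mono {X Y : ObjectProperty C} (h : X ≤ Y) : sums X ≤ sums Y :=
  sums_le_of_closed (h.trans (le_sums Y)) fun _ f => sums_sigma_of_sums f

lemma sums_sums (X : ObjectProperty C) : sums (sums X) = sums X :=
  le_antisymm (sums_le_of_closed le_rfl fun _ f => sums_sigma_of_sums f) (le_sums _)

lemma sums_isoClosure (X : ObjectProperty C) : sums X.isoClosure = sums X :=
  le_antisymm
    (sums_le_of_closed ((ObjectProperty.isoClosure_le_iff _ _).2 (le_sums X))
      fun _ f => sums_sigma_of_sums f)
    (sums_mono X.le_isoClosure)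

lemma le_addClosure (X : ObjectProperty C) : X ≤ addClosure X :=
  (le_sums X).trans (sums X).le_retractClosure

lemma addClosure_sigma {X : ObjectProperty C} {J : Type v} (f : J → C)
    (hf : ∀ j, addClosure X (f j)) : addClosure X (∐ f) := by
  choose g hg r using hf
  exact ⟨∐ g, sums_sigma_of_sums g hg,
    ⟨{ i := Limits.Sigma.map fun j => (r j).some.i
       r := Limits.Sigma.map fun j => (r j).some.r
       retract := Sigma.hom_ext _ _ fun j => by simp }⟩⟩

lemma addClosure_le_of_closed {X Y : ObjectProperty C} [Y.IsStableUnderRetracts] (h : X ≤ Y)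
    (hY : ∀ (J : Type v) (f : J → C), (∀ j, Y (f j)) → Y (∐ f)) : addClosure X ≤ Y :=
  ((sums X).retractClosure_le_iff Y).2 (sums_le_of_closed h hY)

lemma addClosure_le_addClosure {X Y : ObjectProperty C} (h : X ≤ addClosure Y) :
    addClosure X ≤ addClosure Y :=
  addClosure_le_of_closed h fun _ f => addClosure_sigma f

lemma sums_addClosure (X : ObjectProperty C) : sums (addClosure X) = addClosure X :=
  le_antisymm (sums_le_of_closed le_rfl fun _ f => addClosure_sigma f) (le_sums _)

instance : (isProjective C).IsStableUnderRetracts where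
  of_retract r h := by
    have : Projective _ := h
    exact r.projective

lemma isProjective_sigma {J : Type v} (f : J → C) (hf : ∀ j, isProjective C (f j)) :
    isProjective C (∐ f) := by
  have (j : J) : Projective (f j) := hf j
  exact inferInstanceAs (Projective (∐ f))

lemma addClosure_isProjective : addClosure (isProjective C) = isProjective C :=
  le_antisymm (addClosure_le_of_closed le_rfl fun _ f => isProjective_sigma f) (le_addClosure _)

end Sums

section ZeroSummands

lemma isIso_inj_of_isZero {C : Type*} [Category* C] [HasZeroMorphisms C] {J : Type*} {f : J → C}
    {c : Cofan f} (hc : IsColimit c) (i : J) (h : ∀ j, j ≠ i → IsZero (f j)) :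
    IsIso (c.inj i) := by
  classical
  let r : c.pt ⟶ f i := Cofan.IsColimit.desc hc fun j =>
    if hj : j = i then eqToHom (by rw [hj]) else 0
  have hr : c.inj i ≫ r = 𝟙 _ := by simp [r]
  refine ⟨r, hr, Cofan.IsColimit.hom_ext hc _ _ fun j => ?_⟩
  by_cases hj : j = i
  · subst hj
    rw [reassoc_of% hr, Category.comp_id]
  · exact (h j hj).eq_of_src _ _

end ZeroSummands

/-! ### Closure properties of `Phi` and decomposition into free representations -/

section PhiClass

variable {Q : Type v} [Quiver.{v} Q] {A : Type u} [Category.{v} A] [HasCoproducts.{v} A]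

lemma freeReps_le {X : ObjectProperty A} {Y : ObjectProperty (Rep Q A)}
    [Y.IsClosedUnderIsomorphisms] (h : ∀ (v : Q) (x : A), X x → Y (freeRep v x)) :
    freeReps Q X ≤ Y := by
  rintro F ⟨v, x, hx, ⟨e⟩⟩
  exact Y.prop_of_iso e.symm (h v x hx)

lemma freeReps_freeRep {X : ObjectProperty A} (v : Q) {x : A} (hx : X x) :
    freeReps Q X (freeRep v x) :=
  ⟨v, x, hx, ⟨Iso.refl _⟩⟩

instance {J : Type*} [Category* J] (v : Q) : PreservesColimitsOfShape J (freeFunctor A v) :=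
  (freeAdjunction A v).leftAdjoint_preservesColimits.preservesColimitsOfShape

lemma freeReps_sums_le (X : ObjectProperty A) : freeReps Q (sums X) ≤ sums (freeReps Q X) := by
  refine freeReps_le fun v x hx => ?_
  obtain ⟨J, f, hf, ⟨e⟩⟩ := sums_iff.1 hx
  exact sums_iff.2 ⟨J, fun j => freeRep v (f j), fun j => freeReps_freeRep v (hf j),
    ⟨(freeFunctor A v).mapIso e ≪≫ PreservesCoproduct.iso (freeFunctor A v) f⟩⟩

lemma freeReps_addClosure_le (X : ObjectProperty A) :
    freeReps Q (addClosure X) ≤ addClosure (freeReps Q X) := by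
  refine freeReps_le fun v x ⟨y, hy, ⟨r⟩⟩ => ?_
  exact ⟨freeRep v y, freeReps_sums_le X _ (freeReps_freeRep v hy),
    ⟨r.map (freeFunctor A v)⟩⟩

variable [Abelian A]

lemma Phi_iff {X : ObjectProperty A} {F : Rep Q A} :
    Phi Q X F ↔ ∀ w : Q, Mono (phi F w) ∧ X.isoClosure ((phiCoker A w).obj F) :=
  Iff.rfl

lemma Phi_mono {X Y : ObjectProperty A} (h : X ≤ Y) : Phi Q X ≤ Phi Q Y := fun _ hF w =>
  ⟨(hF w).1, ObjectProperty.monotone_isoClosure h _ (hF w).2⟩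

instance (X : ObjectProperty A) : (Phi Q X).IsClosedUnderIsomorphisms where
  of_iso e h := Phi_iff.2 fun w => by
    have := (Phi_iff.1 h w).1
    exact ⟨mono_phi_of_retract e.symm.retract w,
      X.isoClosure.prop_of_iso ((phiCoker A w).mapIso e) (Phi_iff.1 h w).2⟩

instance (X : ObjectProperty A) [X.IsStableUnderRetracts] :
    (Phi Q X).IsStableUnderRetracts where
  of_retract r h := Phi_iff.2 fun w => by
    have := (Phi_iff.1 h w).1
    have h' := (Phi_iff.1 h w).2
    rw [X.isoClosure_eq_self] at h' ⊢
    exact ⟨mono_phi_of_retract r w, X.prop_of_retract (r.map (phiCoker A w)) h'⟩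

lemma sums_Phi_le [AB4OfSize.{v} A] (X : ObjectProperty A) :
    sums (Phi Q X) ≤ Phi Q (sums X) := by
  intro F hF
  obtain ⟨J, f, hf, ⟨e⟩⟩ := sums_iff.1 hF
  refine (Phi Q (sums X)).prop_of_iso e.symm (Phi_iff.2 fun w => ⟨?_, ?_⟩)
  · exact mono_phi_of_isColimit (colimit.isColimit (Discrete.functor f)) w
      fun j => (Phi_iff.1 (hf j.as) w).1
  · refine (sums X).le_isoClosure _ ((sums X).prop_of_iso
      (PreservesCoproduct.iso (phiCoker A w) f).symm ?_)
    rw [← sums_isoClosure]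
    exact sums_sigma _ fun j => (Phi_iff.1 (hf j) w).2

lemma freeRep_Phi {X : ObjectProperty A} {x : A} (hx : X x) {Z : A} (hZ : IsZero Z) (hZX : X Z)
    (v : Q) : Phi Q X (freeRep v x) := Phi_iff.2 fun w => by
  refine ⟨inferInstance, ?_⟩
  by_cases h : v = w
  · subst h
    exact ⟨_, hx, ⟨phiCokerFreeRepIso v x⟩⟩
  · exact ⟨_, hZX, ⟨(isZero_phiCoker_freeRep h x).iso hZ⟩⟩

/-- The cokernel at `w` commutes with the coproduct and kills every summand except the one at `w`.
-/
lemma isIso_phiCoker_map_ι (X : Q → A) (w : Q) :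
    IsIso ((phiCoker A w).map (Sigma.ι (fun u => freeRep u (X u)) w)) :=
  isIso_inj_of_isZero (isColimitCofanMkObjOfIsColimit (phiCoker A w) _ _
    (coproductIsCoproduct fun u => freeRep u (X u))) w
    fun _ hu => isZero_phiCoker_freeRep hu _

/-- The cokernel of `phi` at `w` for a coproduct of representations `freeRep u (X u)`. -/
noncomputable def phiCokerSigmaIso (X : Q → A) (w : Q) :
    (phiCoker A w).obj (∐ fun u => freeRep u (X u)) ≅ X w :=
  have := isIso_phiCoker_map_ι X w
  (asIso ((phiCoker A w).map (Sigma.ι (fun u => freeRep u (X u)) w))).symm ≪≫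
    phiCokerFreeRepIso w (X w)

lemma mono_phi_sigma [AB4OfSize.{v} A] (X : Q → A) (w : Q) :
    Mono (phi (∐ fun u => freeRep u (X u)) w) :=
  mono_phi_of_isColimit (colimit.isColimit (Discrete.functor fun u => freeRep u (X u))) w
    fun _ => mono_phi_freeRep _ _ _

lemma nonempty_iso_sigma_freeRep [AB4OfSize.{v} A] (hQ : IsLeftRooted Q) {F : Rep Q A}
    (hF : Phi Q (isProjective A) F) :
    Nonempty (F ≅ ∐ fun w : Q => freeRep w ((phiCoker A w).obj F)) := by
  have (w : Q) : Projective ((phiCoker A w).obj F) := by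
    have := (Phi_iff.1 hF w).2
    rwa [ObjectProperty.isoClosure_eq_self] at this
  -- Projectivity splits `phiπ F w`; each section is a map into `F.at w`, extended freely.
  let θ : (∐ fun w : Q => freeRep w ((phiCoker A w).obj F)) ⟶ F :=
    Sigma.desc fun w => freeDesc (Projective.factorThru (𝟙 _) (phiπ F w))
  have : IsIso θ := by
    refine isIso_of_isIso_phiCoker_map hQ θ (mono_phi_sigma _)
      (fun w => (Phi_iff.1 hF w).1) fun w => ?_
    have := isIso_phiCoker_map_ι (fun w : Q => (phiCoker A w).obj F) w
    -- On the only surviving summand, `θ` induces the section followed by `phiπ`, which is the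
    -- identity.
    have h : (phiCokerFreeRepIso w ((phiCoker A w).obj F)).inv ≫
        (phiCoker A w).map (Sigma.ι (fun u => freeRep u ((phiCoker A u).obj F)) w) ≫
          (phiCoker A w).map θ = 𝟙 _ := by
      rw [← Functor.map_comp, Sigma.ι_desc, phiCokerFreeRepIso_inv_map, Projective.factorThru_comp]
    rw [← Category.assoc] at h
    exact (IsIso.eq_inv_of_hom_inv_id h) ▸ inferInstance
  exact ⟨(asIso θ).symm⟩

end PhiClass

/-! ### Statements 1–3 -/

section Projectives

variable {Q : Type v} [Quiver.{v} Q] {A : Type u} [Category.{v} A] [Abelian A]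
  [HasCoproducts.{v} A] [AB4OfSize.{v} A]

theorem Phi_sums_eq (hQ : IsLeftRooted Q) {X : ObjectProperty A} (hX : X ≤ isProjective A) :
    Phi Q (sums X) = sums (freeReps Q X) := by
  apply le_antisymm
  · intro F hF
    have hp : sums X ≤ isProjective A := sums_le_of_closed hX fun _ f => isProjective_sigma f
    obtain ⟨e⟩ := nonempty_iso_sigma_freeRep hQ (Phi_mono hp _ hF)
    refine (sums (freeReps Q X)).prop_of_iso e.symm (sums_sigma_of_sums _ fun w => ?_)
    have := (Phi_iff.1 hF w).2
    rw [ObjectProperty.isoClosure_eq_self] at this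
    exact freeReps_sums_le X _ (freeReps_freeRep w this)
  · calc sums (freeReps Q X) ≤ sums (Phi Q (sums X)) :=
          sums_mono (freeReps_le fun v x hx => freeRep_Phi (le_sums X _ hx) (isZero_zero A)
            (sums_isZero X (isZero_zero A)) v)
      _ ≤ Phi Q (sums (sums X)) := sums_Phi_le _
      _ = Phi Q (sums X) := by rw [sums_sums]

theorem Phi_sums_eq_of_containsZero (hQ : IsLeftRooted Q) {X : ObjectProperty A}
    (hX : X ≤ isProjective A) [X.ContainsZero] : Phi Q (sums X) = sums (Phi Q X) := by
  refine le_antisymm ?_ (sums_Phi_le X)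
  obtain ⟨Z, hZ, hZX⟩ := X.exists_prop_of_containsZero
  rw [Phi_sums_eq hQ hX]
  exact sums_mono (freeReps_le fun v x hx => freeRep_Phi hx hZ hZX v)

/-- When `0` is not in `X`, `freeRep v x` may fail to lie in `Phi Q X`, its cokernels away from `v`
being zero. Placing `x` at every vertex repairs this and keeps `freeRep v x` as a summand. -/
lemma freeReps_le_addClosure_Phi (X : ObjectProperty A) :
    freeReps Q X ≤ addClosure (Phi Q X) := by
  classical
  refine freeReps_le fun v x hx => ⟨∐ fun w : Q => freeRep w x, le_sums _ _ ?_, ⟨?_⟩⟩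
  · exact Phi_iff.2 fun w => ⟨mono_phi_sigma _ w, x, hx, ⟨phiCokerSigmaIso (fun _ => x) w⟩⟩
  · exact { i := Sigma.ι (fun w : Q => freeRep w x) v
            r := Sigma.desc fun w => if h : w = v then eqToHom (by rw [h]) else 0
            retract := by simp }

theorem Phi_addClosure_eq (hQ : IsLeftRooted Q) {X : ObjectProperty A}
    (hX : X ≤ isProjective A) :
    Phi Q (addClosure X) = addClosure (freeReps Q X) ∧
      Phi Q (addClosure X) = addClosure (Phi Q X) := by
  have hp : addClosure X ≤ isProjective A :=
    addClosure_le_of_closed hX fun _ f => isProjective_sigma f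
  have h₁ : Phi Q (addClosure X) ≤ addClosure (freeReps Q X) := by
    rw [← sums_addClosure, Phi_sums_eq hQ hp, ← sums_addClosure (freeReps Q X)]
    exact sums_mono (freeReps_addClosure_le X)
  have h₂ : addClosure (freeReps Q X) ≤ addClosure (Phi Q X) :=
    addClosure_le_addClosure (freeReps_le_addClosure_Phi X)
  have h₃ : addClosure (Phi Q X) ≤ Phi Q (addClosure X) :=
    addClosure_le_of_closed (Phi_mono (le_addClosure X)) fun J f hf => by
      rw [← sums_addClosure]
      exact sums_Phi_le _ _ (sums_sigma f hf)
  exact ⟨le_antisymm h₁ (h₂.trans h₃), le_antisymm (h₁.trans h₂) h₃⟩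

instance projective_freeRep (v : Q) (X : A) [Projective X] : Projective (freeRep v X) :=
  (freeAdjunction A v).map_projective X inferInstance

theorem Phi_isProjective_eq (hQ : IsLeftRooted Q) [EnoughProjectives A] :
    Phi Q (isProjective A) = isProjective (Rep Q A) := by
  have h := (Phi_addClosure_eq hQ (le_refl (isProjective A))).1
  rw [addClosure_isProjective] at h
  apply le_antisymm
  · rw [h]
    refine addClosure_le_of_closed (freeReps_le fun v x hx => ?_) fun _ f => isProjective_sigma f
    have : Projective x := hx
    exact projective_freeRep v x
  · intro P hP
    have : Projective P := hP
    -- Projective covers of the values, in the weak sense of epimorphisms from projectives, exhibit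
    -- `P` as a retract of a sum of free representations.
    let g : (∐ fun w : Q => freeRep w (Projective.over (P.at w))) ⟶ P :=
      Sigma.desc fun w => freeDesc (Projective.π (P.at w))
    have : Epi g := by
      have (w : Q) : Epi (g.app ((Paths.of Q).obj w)) := by
        refine epi_of_epi_fac (f := freeι w _ .nil ≫
          (Sigma.ι (fun w : Q => freeRep w (Projective.over (P.at w))) w).app _)
          (h := Projective.π (P.at w)) ?_
        rw [Category.assoc, ← NatTrans.comp_app, Sigma.ι_desc, freeι_nil_freeDesc]
      have (w : Paths Q) : Epi (g.app w) := this w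
      exact NatTrans.epi_of_epi_app g
    rw [h]
    exact ⟨_, sums_sigma _ fun w => freeReps_freeRep w (inferInstanceAs (Projective _)),
      ⟨⟨Projective.factorThru (𝟙 P) g, g, Projective.factorThru_comp _ _⟩⟩⟩

end Projectives

/-! ### Finitely generated projective objects -/

section FinitelyGenerated

variable {C : Type u} [Category.{v} C]

lemma IsFinitelyGenerated.of_retract {X Y : C} (r : Retract X Y) (hY : IsFinitelyGenerated Y) :
    IsFinitelyGenerated X := by
  intro J _ _ F c hc j f g hfg
  obtain ⟨k, t, ht⟩ := hY J F c hc j (r.r ≫ f) (r.r ≫ g) (by simp [hfg])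
  refine ⟨k, t, ?_⟩
  rwa [Category.assoc, Category.assoc, cancel_epi] at ht

instance : (fgProj C).IsStableUnderRetracts where
  of_retract r h := ⟨h.1.of_retract r, have := h.2; r.projective⟩

lemma IsFinitelyGenerated.of_adjunction {D : Type*} [Category.{v} D] {L : C ⥤ D} {R : D ⥤ C}
    (adj : L ⊣ R) [PreservesFilteredColimitsOfSize.{v, v} R] {X : C}
    (hX : IsFinitelyGenerated X) : IsFinitelyGenerated (L.obj X) := by
  intro J _ _ F c hc j f g hfg
  obtain ⟨k, t, ht⟩ := hX J (F ⋙ R) (R.mapCocone c) (isColimitOfPreserves R hc) j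
    (adj.homEquiv _ _ f) (adj.homEquiv _ _ g) (by
      dsimp
      rw [← adj.homEquiv_naturality_right, ← adj.homEquiv_naturality_right, hfg])
  refine ⟨k, t, (adj.homEquiv _ _).injective ?_⟩
  rw [adj.homEquiv_naturality_right, adj.homEquiv_naturality_right]
  exact ht

lemma IsFinitelyGenerated.of_map {D : Type*} [Category.{v} D] (L : C ⥤ D) [L.Faithful]
    [PreservesFilteredColimitsOfSize.{v, v} L] {X : C}
    (hX : IsFinitelyGenerated (L.obj X)) : IsFinitelyGenerated X := by
  intro J _ _ F c hc j f g hfg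
  obtain ⟨k, t, ht⟩ := hX J (F ⋙ L) (L.mapCocone c) (isColimitOfPreserves L hc) j
    (L.map f) (L.map g) (by
      dsimp
      rw [← L.map_comp, ← L.map_comp, hfg])
  refine ⟨k, t, L.map_injective ?_⟩
  rw [L.map_comp, L.map_comp]
  exact ht

lemma IsFinitelyGenerated.biprod [HasZeroMorphisms C] {X Y : C} [HasBinaryBiproduct X Y]
    (hX : IsFinitelyGenerated X) (hY : IsFinitelyGenerated Y) : IsFinitelyGenerated (X ⊞ Y) := by
  intro J _ _ F c hc j f g hfg
  obtain ⟨k₁, t₁, h₁⟩ := hX J F c hc j (biprod.inl ≫ f) (biprod.inl ≫ g) (by simp [hfg])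
  obtain ⟨k₂, t₂, h₂⟩ := hY J F c hc j (biprod.inr ≫ f) (biprod.inr ≫ g) (by simp [hfg])
  obtain ⟨k, s₁, s₂, hs⟩ := IsFiltered.span t₁ t₂
  refine ⟨k, t₁ ≫ s₁, biprod.hom_ext' _ _ ?_ ?_⟩
  · simpa using h₁ =≫ F.map s₁
  · rw [hs]
    simpa using h₂ =≫ F.map s₂

lemma fgProj_biprod [HasZeroMorphisms C] {X Y : C} [HasBinaryBiproduct X Y]
    (hX : fgProj C X) (hY : fgProj C Y) : fgProj C (X ⊞ Y) :=
  have := hX.2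
  have := hY.2
  ⟨hX.1.biprod hY.1, inferInstance⟩

lemma enoughProjectives_of_isSeparating [HasCoproducts.{v} C] {I : Type v} {p : I → C}
    (hp : ∀ i, Projective (p i)) (hs : (ObjectProperty.ofObj p).IsSeparating) :
    EnoughProjectives C where
  presentation X :=
    let g : (∐ fun a : (Σ i, (p i ⟶ X)) => p a.1) ⟶ X := Sigma.desc fun a => a.2
    have : Epi g := ⟨fun u v huv => hs _ _ (by
      rintro _ ⟨i⟩ h
      simpa [g] using Sigma.ι (fun a : (Σ i, (p i ⟶ X)) => p a.1) ⟨i, h⟩ ≫= huv)⟩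
    ⟨{ p := _, f := g }⟩

section Abelian

open scoped ZeroObject

variable [Abelian C]

/-- The cokernels of the morphisms of a cocone to its point. -/
@[simps]
noncomputable def coconeCokernels {J : Type*} [Category* J] {F : J ⥤ C} (c : Cocone F) :
    J ⥤ C where
  obj j := cokernel (c.ι.app j)
  map {i j} f := cokernel.map _ _ (F.map f) (𝟙 c.pt) (by simp)
  map_id j := coequalizer.hom_ext (by simp)
  map_comp f g := coequalizer.hom_ext (by simp)

/-- The projections onto `coconeCokernels`. -/
noncomputable def coconeCokernelsπ {J : Type*} [Category* J] {F : J ⥤ C} (c : Cocone F) (j : J) :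
    c.pt ⟶ (coconeCokernels c).obj j :=
  cokernel.π (c.ι.app j)

instance {J : Type*} [Category* J] {F : J ⥤ C} (c : Cocone F) (j : J) :
    Epi (coconeCokernelsπ c j) :=
  inferInstanceAs (Epi (cokernel.π _))

lemma ι_coconeCokernelsπ {J : Type*} [Category* J] {F : J ⥤ C} (c : Cocone F) (j : J) :
    c.ι.app j ≫ coconeCokernelsπ c j = 0 :=
  cokernel.condition _

lemma coconeCokernelsπ_map {J : Type*} [Category* J] {F : J ⥤ C} (c : Cocone F) {i j : J}
    (f : i ⟶ j) : coconeCokernelsπ c i ≫ (coconeCokernels c).map f = coconeCokernelsπ c j :=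
  (cokernel.π_desc _ _ _).trans (Category.id_comp _)

lemma coconeCokernels_exact {J : Type*} [Category* J] {F : J ⥤ C} (c : Cocone F) (j : J) :
    (ShortComplex.mk (c.ι.app j) (coconeCokernelsπ c j) (ι_coconeCokernelsπ c j)).Exact :=
  ShortComplex.exact_cokernel _

/-- The colimit of the cokernels of the morphisms of a colimit cocone is zero. -/
noncomputable def isColimitCoconeCokernels {J : Type*} [Category* J] [IsFiltered J] {F : J ⥤ C}
    {c : Cocone F} (hc : IsColimit c) :
    IsColimit (Cocone.mk 0 0 : Cocone (coconeCokernels c)) := by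
  have key (s : Cocone (coconeCokernels c)) (j : J) : s.ι.app j = 0 := by
    have h {i k : J} (f : i ⟶ k) :
        coconeCokernelsπ c i ≫ s.ι.app i = coconeCokernelsπ c k ≫ s.ι.app k := by
      rw [← s.w f, ← Category.assoc, coconeCokernelsπ_map]
    -- The composite is independent of the index, so on the leg from `F.obj i` it may be computed at
    -- `i`, where it vanishes.
    have h₀ : coconeCokernelsπ c j ≫ s.ι.app j = 0 := by
      refine hc.hom_ext fun i => ?_
      rw [h (IsFiltered.leftToMax j i), ← h (IsFiltered.rightToMax j i), ← Category.assoc,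
        ι_coconeCokernelsπ, zero_comp, comp_zero]
    rw [← cancel_epi (coconeCokernelsπ c j), h₀, comp_zero]
  exact
    { desc s := 0
      fac s j := by rw [key s j, comp_zero]
      uniq s m _ := (isZero_zero C).eq_of_src _ _ }

/-- The quotients of `c.pt` by the images of the `F.obj j` have colimit zero. Finite generation
makes `x` vanish in one of them, and projectivity lifts it to that stage. -/
lemma exists_lift_of_fgProj {P : C} (hP : fgProj C P) {J : Type v} [SmallCategory J]
    [IsFiltered J] {F : J ⥤ C} {c : Cocone F} (hc : IsColimit c) (x : P ⟶ c.pt) :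
    ∃ (j : J) (y : P ⟶ F.obj j), y ≫ c.ι.app j = x := by
  have := hP.2
  let j₀ : J := Classical.choice IsFiltered.nonempty
  obtain ⟨k, t, ht⟩ := hP.1 J _ _ (isColimitCoconeCokernels hc) j₀
    (x ≫ coconeCokernelsπ c j₀) 0 ((isZero_zero C).eq_of_tgt _ _)
  rw [Category.assoc, coconeCokernelsπ_map, zero_comp] at ht
  exact ⟨k, (coconeCokernels_exact c k).liftFromProjective x ht,
    ShortComplex.Exact.liftFromProjective_comp _ _ _⟩

lemma fgProj_le_isFinitelyPresentable :
    fgProj C ≤ ObjectProperty.isFinitelyPresentable.{v} C := fun P hP =>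
  isFinitelyPresentable_iff_preservesFilteredColimits.2
    ⟨fun J _ _ => ⟨fun {F} => ⟨fun {c} hc => ⟨Types.FilteredColimit.isColimitOf' _ _
      (fun x => by
        obtain ⟨j, y, hy⟩ := exists_lift_of_fgProj hP hc x
        exact ⟨j, y, hy.symm⟩)
      fun j f g h => hP.1 J F c hc j f g h⟩⟩⟩⟩

lemma isStrongGenerator_of_isSeparating {P : ObjectProperty C} (hP : P.IsSeparating) :
    P.IsStrongGenerator := by
  refine ObjectProperty.isStrongGenerator_iff.2 ⟨hP, fun X Y i _ hi => ?_⟩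
  have : Epi i := ⟨fun u v huv => hP _ _ fun G hG g => by
    obtain ⟨f, rfl⟩ := hi G hG g
    simp [huv]⟩
  exact isIso_of_mono_of_epi i

/-- Finitely generated projectives are finitely presentable, hence form an essentially small class;
this allows a generating coproduct over a set. -/
lemma exists_small_fgProj (hC : IsLocallyFinitelyPresentable.{v} C)
    (hs : (fgProj C).IsSeparating) :
    ∃ (I : Type v) (p : I → C), (∀ i, fgProj C (p i)) ∧
      (ObjectProperty.ofObj p).IsSeparating := by
  have : Fact (Cardinal.aleph0.{v}).IsRegular := Cardinal.fact_isRegular_aleph0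
  have : ObjectProperty.EssentiallySmall.{v} (ObjectProperty.isFinitelyPresentable.{v} C) :=
    inferInstanceAs (ObjectProperty.EssentiallySmall.{v} (isCardinalPresentable C _))
  have : ObjectProperty.EssentiallySmall.{v} (fgProj C) :=
    .of_le fgProj_le_isFinitelyPresentable
  obtain ⟨P, _, h₁, h₂⟩ := ObjectProperty.EssentiallySmall.exists_small_le.{v} (fgProj C)
  refine ⟨Shrink (Subtype P), fun i => ((equivShrink _).symm i).1,
    fun i => h₁ _ ((equivShrink _).symm i).2, fun X Y f g h => hs _ _ fun G hG a => ?_⟩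
  obtain ⟨G', hG', ⟨e⟩⟩ := h₂ _ hG
  have := h G' (by
    simpa using ObjectProperty.ofObj_apply
      (fun i : Shrink.{v} (Subtype P) => ((equivShrink _).symm i).1) (equivShrink _ ⟨G', hG'⟩))
      (e.inv ≫ a)
  simpa using this

end Abelian

end FinitelyGenerated

/-! ### Finitely generated projective representations -/

section FgProjRep

variable {Q : Type v} [Quiver.{v} Q] {A : Type u} [Category.{v} A] [Abelian A]

lemma mono_freeι_nil [HasCoproducts.{v} A] (v : Q) (X : A) : Mono (freeι v X .nil) :=
  have : IsSplitMono (freeι v X .nil) :=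
    ⟨⟨freeAtDesc v fun p => if p.length = 0 then 𝟙 X else 0, by simp⟩⟩
  inferInstance

instance [HasCoproducts.{v} A] (v : Q) : (freeFunctor A v).Faithful where
  map_injective {X Y f g} h := by
    have := mono_freeι_nil v Y
    have key (f : X ⟶ Y) : freeι v X .nil ≫
        ((freeFunctor A v).map f).app ((Paths.of Q).obj v) = f ≫ freeι v Y .nil :=
      Sigma.ι_desc _ _
    rw [← cancel_mono (freeι v Y .nil), ← key, ← key, h]

variable [HasColimits A]

lemma fgProj_freeRep (v : Q) {X : A} (hX : fgProj A X) : fgProj (Rep Q A) (freeRep v X) :=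
  ⟨hX.1.of_adjunction (freeAdjunction A v), (freeAdjunction A v).map_projective X hX.2⟩

/-- The decomposition of `P` makes `freeRep w` of its cokernel at `w` a retract of `P`, hence
finitely generated; the faithful functor `freeFunctor A w`, preserving filtered colimits, reflects
this. -/
lemma fgProj_phiCoker [AB4OfSize.{v} A] (hQ : IsLeftRooted Q) [EnoughProjectives A]
    {P : Rep Q A} (hP : fgProj (Rep Q A) P) (w : Q) :
    Mono (phi P w) ∧ fgProj A ((phiCoker A w).obj P) := by
  classical
  have h : Phi Q (isProjective A) P := by
    rw [Phi_isProjective_eq hQ]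
    exact hP.2
  have hw := (Phi_iff.1 h w).2
  rw [ObjectProperty.isoClosure_eq_self] at hw
  refine ⟨(Phi_iff.1 h w).1, ?_, hw⟩
  obtain ⟨e⟩ := nonempty_iso_sigma_freeRep hQ h
  let X (w : Q) := (phiCoker A w).obj P
  let r : Retract (freeRep w (X w)) (∐ fun w : Q => freeRep w (X w)) :=
    { i := Sigma.ι (fun w : Q => freeRep w (X w)) w
      r := Sigma.desc fun u => if h : u = w then eqToHom (by rw [h]) else 0
      retract := by simp }
  have : PreservesFilteredColimitsOfSize.{v, v} (freeFunctor A w) :=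
    ⟨fun _ _ _ => inferInstance⟩
  exact .of_map (freeFunctor A w) ((hP.1.of_retract e.symm.retract).of_retract r)

theorem ind_fgProj_le_Phi [AB5 A] (hQ : IsLeftRooted Q) [EnoughProjectives A] :
    ObjectProperty.ind.{v} (fgProj (Rep Q A)) ≤ Phi Q (ObjectProperty.ind.{v} (fgProj A)) := by
  have := Abelian.hasFiniteBiproducts (C := A)
  have : AB4OfSize.{v} A := AB4.of_AB5 A
  rintro F ⟨J, _, _, pres, h⟩
  refine Phi_iff.2 fun w => ⟨mono_phi_of_isColimit pres.isColimit w
    fun j => (fgProj_phiCoker hQ (h j) w).1, ObjectProperty.le_isoClosure _ _ ?_⟩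
  exact ⟨J, inferInstance, inferInstance, pres.map (phiCoker A w),
    fun j => (fgProj_phiCoker hQ (h j) w).2⟩

/-- By adjunction, the free representations on a small generating family of `A` detect equality at
every vertex. -/
lemma isLocallyFinitelyPresentable_rep (hA : IsLocallyFinitelyPresentable.{v} A)
    (hs : (fgProj A).IsSeparating) : IsLocallyFinitelyPresentable.{v} (Rep Q A) := by
  have : Fact (Cardinal.aleph0.{v}).IsRegular := Cardinal.fact_isRegular_aleph0
  obtain ⟨I, p, hp, hsep⟩ := exists_small_fgProj hA hs
  refine (IsCardinalLocallyPresentable.iff_exists_isStrongGenerator _ _).2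
    ⟨ObjectProperty.ofObj fun a : Q × I => freeRep a.1 (p a.2), inferInstance,
      isStrongGenerator_of_isSeparating fun F G α β h => ?_, ?_⟩
  · suffices ∀ w : Q, α.app ((Paths.of Q).obj w) = β.app ((Paths.of Q).obj w) from
      NatTrans.ext (funext this)
    intro w
    refine hsep _ _ ?_
    rintro _ ⟨i⟩ s
    have := h _ (ObjectProperty.ofObj_apply
      (fun a : Q × I => freeRep a.1 (p a.2)) (w, i)) (freeDesc (F := F) s)
    have h' : freeι w (p i) .nil ≫ (freeDesc s ≫ α).app ((Paths.of Q).obj w) =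
        freeι w (p i) .nil ≫ (freeDesc s ≫ β).app ((Paths.of Q).obj w) := by rw [this]
    rwa [NatTrans.comp_app, NatTrans.comp_app, freeι_nil_freeDesc_assoc,
      freeι_nil_freeDesc_assoc] at h'
  · rintro _ ⟨a⟩
    exact fgProj_le_isFinitelyPresentable _ (fgProj_freeRep a.1 (hp a.2))

end FgProjRep

/-! ### Factoring morphisms into a free representation -/

section FactorizationFree

variable {Q : Type v} [Quiver.{v} Q] {A : Type u} [Category.{v} A] [HasCoproducts.{v} A]

lemma fgProj_isZero {C : Type*} [Category.{v} C] {X : C} (hX : IsZero X) : fgProj C X :=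
  ⟨fun _ _ _ _ _ _ j _ _ _ => ⟨j, 𝟙 j, hX.eq_of_src _ _⟩, hX.projective⟩

lemma exists_factorization_freeRep {w : Q} {X : A} (hX : ObjectProperty.ind.{v} (fgProj A) X)
    {M : Rep Q A} [IsFinitelyPresentable.{v} M] (y : M ⟶ freeRep w X) :
    ∃ (P : A) (z : M ⟶ freeRep w P) (t : freeRep w P ⟶ freeRep w X), z ≫ t = y ∧ fgProj A P := by
  obtain ⟨J, _, _, pres, hpres⟩ := hX
  obtain ⟨j, z, hz⟩ := IsFinitelyPresentable.exists_hom_of_isColimit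
    (pres.map (freeFunctor A w)).isColimit y
  exact ⟨pres.diag.obj j, z, _, hz, hpres j⟩

end FactorizationFree

/-! ### Quotients vanishing on a set of vertices, and factorization -/

section KillAt

open scoped ZeroObject

variable {Q : Type v} [Quiver.{v} Q] {A : Type u} [Category.{v} A] [Abelian A] [HasColimits A]

/-- The morphism to `F` from the coproduct of the representations `freeRep w (F.at w)` with `w`
in `S`. -/
noncomputable def genMap (F : Rep Q A) (S : Set Q) :
    (∐ fun w : S => freeRep w.1 (F.at w.1)) ⟶ F :=
  Sigma.desc fun w => freeDesc (𝟙 (F.at w.1))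

/-- The largest quotient of a representation which is zero at the vertices in `S`. -/
noncomputable def killAt (F : Rep Q A) (S : Set Q) : Rep Q A := cokernel (genMap F S)

/-- The projection onto `killAt F S`. -/
noncomputable def killπ (F : Rep Q A) (S : Set Q) : F ⟶ killAt F S := cokernel.π (genMap F S)

instance (F : Rep Q A) (S : Set Q) : Epi (killπ F S) := inferInstanceAs (Epi (cokernel.π _))

lemma genMap_killπ (F : Rep Q A) (S : Set Q) : genMap F S ≫ killπ F S = 0 :=
  cokernel.condition _

lemma genMap_exact (F : Rep Q A) (S : Set Q) :
    (ShortComplex.mk (genMap F S) (killπ F S) (genMap_killπ F S)).Exact :=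
  ShortComplex.exact_cokernel _

lemma genMap_comp_eq_zero_iff {F G : Rep Q A} {S : Set Q} (α : F ⟶ G) :
    genMap F S ≫ α = 0 ↔ ∀ w ∈ S, α.app ((Paths.of Q).obj w) = 0 := by
  have h (w : S) : Sigma.ι (fun w : S => freeRep w.1 (F.at w.1)) w ≫ genMap F S ≫ α =
      freeDesc (α.app ((Paths.of Q).obj w.1)) := by
    rw [genMap, Sigma.ι_desc_assoc, freeDesc_comp, Category.id_comp]
  constructor
  · intro hα w hw
    have h' := h ⟨w, hw⟩
    rw [hα, comp_zero] at h'
    rw [← freeι_nil_freeDesc (α.app ((Paths.of Q).obj w)), ← h']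
    exact comp_zero
  · intro hα
    refine Sigma.hom_ext _ _ fun w => ?_
    rw [h, hα _ w.2, comp_zero]
    exact freeRep_hom_ext ((freeι_nil_freeDesc _).trans comp_zero.symm)

lemma killπ_app {F : Rep Q A} {S : Set Q} {w : Q} (hw : w ∈ S) :
    (killπ F S).app ((Paths.of Q).obj w) = 0 :=
  (genMap_comp_eq_zero_iff _).1 (genMap_killπ F S) w hw

/-- The morphism out of `killAt F S` induced by a morphism vanishing at the vertices in `S`. -/
noncomputable def killDesc {F G : Rep Q A} {S : Set Q} (α : F ⟶ G)
    (hα : ∀ w ∈ S, α.app ((Paths.of Q).obj w) = 0) : killAt F S ⟶ G :=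
  cokernel.desc _ α ((genMap_comp_eq_zero_iff α).2 hα)

@[simp]
lemma killπ_killDesc {F G : Rep Q A} {S : Set Q} (α : F ⟶ G)
    (hα : ∀ w ∈ S, α.app ((Paths.of Q).obj w) = 0) : killπ F S ≫ killDesc α hα = α :=
  cokernel.π_desc _ _ _

@[simp]
lemma killπ_killDesc_assoc {F G H : Rep Q A} {S : Set Q} (α : F ⟶ G)
    (hα : ∀ w ∈ S, α.app ((Paths.of Q).obj w) = 0) (β : G ⟶ H) :
    killπ F S ≫ killDesc α hα ≫ β = α ≫ β := by
  rw [← Category.assoc, killπ_killDesc]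

lemma isZero_killAt {F : Rep Q A} {S : Set Q} {w : Q} (hw : w ∈ S) :
    IsZero ((killAt F S).at w) := by
  have : Epi ((killπ F S).app ((Paths.of Q).obj w)) :=
    inferInstanceAs (Epi ((evalAt A w).map (killπ F S)))
  rw [IsZero.iff_id_eq_zero, ← cancel_epi ((killπ F S).app ((Paths.of Q).obj w)),
    killπ_app hw, zero_comp, zero_comp]

lemma eq_zero_of_comp_killπ_empty {F M : Rep Q A} {x : M ⟶ F} (hx : x ≫ killπ F ∅ = 0) :
    x = 0 := by
  rw [← Category.comp_id x, ← killπ_killDesc (S := ∅) (𝟙 F) (by simp), ← Category.assoc, hx,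
    zero_comp]

lemma comp_killπ_univ {F M : Rep Q A} (x : M ⟶ F) : x ≫ killπ F Set.univ = 0 := by
  have h (w : Q) : (killπ F Set.univ).app ((Paths.of Q).obj w) = 0 := killπ_app (Set.mem_univ w)
  have : killπ F Set.univ = 0 := NatTrans.ext (funext h)
  rw [this, comp_zero]

section Chain

/-- The functor `S ↦ killAt F S` on a family of sets of vertices. -/
noncomputable def killFunctor (F : Rep Q A) (c : Set (Set Q)) : c ⥤ Rep Q A where
  obj S := killAt F S.1
  map {S T} f := killDesc (killπ F T.1) fun w hw => killπ_app (leOfHom f hw)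
  map_id S := by simp [← cancel_epi (killπ F S.1)]
  map_comp {S T U} f g := by simp [← cancel_epi (killπ F S.1)]

/-- The projections onto `killFunctor`. -/
noncomputable def killFunctorπ (F : Rep Q A) (c : Set (Set Q)) (S : c) :
    F ⟶ (killFunctor F c).obj S :=
  killπ F S.1

instance (F : Rep Q A) (c : Set (Set Q)) (S : c) : Epi (killFunctorπ F c S) :=
  inferInstanceAs (Epi (killπ F S.1))

lemma killFunctorπ_map (F : Rep Q A) (c : Set (Set Q)) {S T : c} (f : S ⟶ T) :
    killFunctorπ F c S ≫ (killFunctor F c).map f = killFunctorπ F c T :=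
  killπ_killDesc (killπ F T.1) fun _ hw => killπ_app (leOfHom f hw)

/-- The morphism from `killAt F S` to the point of `killCocone`. -/
noncomputable def killCoconeι (F : Rep Q A) (c : Set (Set Q)) (S : c) :
    (killFunctor F c).obj S ⟶ killAt F (⋃₀ c) :=
  killDesc (killπ F (⋃₀ c)) fun _ hw => killπ_app (Set.mem_sUnion_of_mem hw S.2)

lemma killFunctorπ_killCoconeι (F : Rep Q A) (c : Set (Set Q)) (S : c) :
    killFunctorπ F c S ≫ killCoconeι F c S = killπ F (⋃₀ c) :=
  killπ_killDesc _ _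

/-- The cocone with point `killAt F (⋃₀ c)`. -/
noncomputable def killCocone (F : Rep Q A) (c : Set (Set Q)) : Cocone (killFunctor F c) where
  pt := killAt F (⋃₀ c)
  ι :=
    { app S := killCoconeι F c S
      naturality S T f := by
        rw [← cancel_epi (killFunctorπ F c S), ← Category.assoc, killFunctorπ_map,
          killFunctorπ_killCoconeι]
        exact (Category.comp_id _).symm.trans
          (congrArg (· ≫ 𝟙 _) (killFunctorπ_killCoconeι F c S).symm |>.trans
            (Category.assoc _ _ _)) }

/-- For a nonempty directed family `c`, the representation `killAt F (⋃₀ c)` is the colimit of the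
representations `killAt F S` with `S` in `c`. -/
noncomputable def isColimitKillCocone (F : Rep Q A) (c : Set (Set Q)) [IsFiltered c] :
    IsColimit (killCocone F c) := by
  let S₀ : c := Classical.choice IsFiltered.nonempty
  have key (s : Cocone (killFunctor F c)) (S T : c) :
      killFunctorπ F c S ≫ s.ι.app S = killFunctorπ F c T ≫ s.ι.app T := by
    have h {S T : c} (f : S ⟶ T) :
        killFunctorπ F c S ≫ s.ι.app S = killFunctorπ F c T ≫ s.ι.app T := by
      rw [← s.w f, ← Category.assoc, killFunctorπ_map]
    rw [h (IsFiltered.leftToMax S T), ← h (IsFiltered.rightToMax S T)]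
  -- As the composite from `F` does not depend on the member of `c`, vanishing at `w` can be checked
  -- on a member containing `w`.
  have hz (s : Cocone (killFunctor F c)) (w : Q) (hw : w ∈ ⋃₀ c) :
      (killFunctorπ F c S₀ ≫ s.ι.app S₀).app ((Paths.of Q).obj w) = 0 := by
    obtain ⟨S, hS, hw⟩ := hw
    have : (killFunctorπ F c ⟨S, hS⟩).app ((Paths.of Q).obj w) = 0 := killπ_app hw
    rw [key s S₀ ⟨S, hS⟩, NatTrans.comp_app, this, zero_comp]
  let d (s : Cocone (killFunctor F c)) : killAt F (⋃₀ c) ⟶ s.pt :=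
    killDesc (killFunctorπ F c S₀ ≫ s.ι.app S₀) (hz s)
  have hd (s : Cocone (killFunctor F c)) :
      killπ F (⋃₀ c) ≫ d s = killFunctorπ F c S₀ ≫ s.ι.app S₀ := killπ_killDesc _ _
  have fac (s : Cocone (killFunctor F c)) (S : c) : killCoconeι F c S ≫ d s = s.ι.app S := by
    rw [← cancel_epi (killFunctorπ F c S), ← Category.assoc, killFunctorπ_killCoconeι, hd,
      key s S₀ S]
  have uniq (s : Cocone (killFunctor F c)) (m : killAt F (⋃₀ c) ⟶ s.pt)
      (hm : ∀ S : c, killCoconeι F c S ≫ m = s.ι.app S) : m = d s := by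
    rw [← cancel_epi (killπ F (⋃₀ c)), hd, ← hm S₀, ← Category.assoc, killFunctorπ_killCoconeι]
  exact { desc := d, fac := fac, uniq := uniq }

lemma exists_comp_killπ_eq_zero {F M : Rep Q A} [IsFinitelyPresentable.{v} M] {c : Set (Set Q)}
    (hc : IsChain (· ⊆ ·) c) (hne : c.Nonempty) {x : M ⟶ F}
    (hx : x ≫ killπ F (⋃₀ c) = 0) : ∃ S ∈ c, x ≫ killπ F S = 0 := by
  have : Nonempty c := hne.to_subtype
  have : IsDirectedOrder c := ⟨fun S T => by
    obtain h | h := hc.total S.2 T.2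
    · exact ⟨T, h, le_rfl⟩
    · exact ⟨S, le_rfl, h⟩⟩
  have : IsFiltered c := isFiltered_of_directed_le_nonempty c
  let S₀ : c := Classical.choice inferInstance
  have hx' : (x ≫ killFunctorπ F c S₀) ≫ killCoconeι F c S₀ = 0 := by
    rw [Category.assoc, killFunctorπ_killCoconeι, hx]
  obtain ⟨S, f, g, h⟩ := IsFinitelyPresentable.exists_eq_of_isColimit
    (isColimitKillCocone F c) (i := S₀) (j := S₀) (x ≫ killFunctorπ F c S₀) 0
    (hx'.trans zero_comp.symm)
  rw [zero_comp, Category.assoc, killFunctorπ_map] at h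
  exact ⟨S.1, S.2, h⟩

end Chain

section Closed

instance (w : Q) : (phiSource A w).PreservesZeroMorphisms where
  map_zero F G := source_hom_ext fun a => by
    rw [sourceι_map, NatTrans.app_zero, zero_comp, comp_zero]

instance (w : Q) : (phiCoker A w).PreservesZeroMorphisms where
  map_zero F G := by
    rw [← cancel_epi (phiπ F w), phiπ_naturality, NatTrans.app_zero, zero_comp, comp_zero]

lemma isZero_phiSource {F : Rep Q A} {w : Q} (h : ∀ u : Q, Nonempty (u ⟶ w) → IsZero (F.at u)) :
    IsZero ((phiSource A w).obj F) := by
  rw [IsZero.iff_id_eq_zero]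
  exact source_hom_ext fun a => (h a.1 ⟨a.2⟩).eq_of_src _ _

lemma isZero_phiCoker_sigma {S : Set Q} (X : S → A) {w : Q} (hw : w ∉ S) :
    IsZero ((phiCoker A w).obj (∐ fun u : S => freeRep u.1 (X u))) := by
  rw [(PreservesCoproduct.iso (phiCoker A w) fun u : S => freeRep u.1 (X u)).isZero_iff,
    IsZero.iff_id_eq_zero]
  exact Sigma.hom_ext _ _ fun u =>
    (isZero_phiCoker_freeRep (fun h : u.1 = w => hw (h ▸ u.2)) (X u)).eq_of_src _ _

lemma epi_phi_of_isZero {F : Rep Q A} {w : Q} (h : IsZero ((phiCoker A w).obj F)) :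
    Epi (phi F w) :=
  (phi_exact F w).epi_f (h.eq_of_tgt _ _)

/-- For `w ∈ S` the source is zero. Otherwise the four lemma applies to the presentation by
`genMap`, whose source has epic `phi` at `w` because it is generated at vertices other than `w`. -/
lemma mono_phi_killAt {F : Rep Q A} {S : Set Q}
    (hS : ∀ u w : Q, Nonempty (u ⟶ w) → w ∈ S → u ∈ S) (w : Q) [hF : Mono (phi F w)] :
    Mono (phi (killAt F S) w) := by
  by_cases hw : w ∈ S
  · have h := isZero_phiSource (F := killAt F S) (w := w)
      fun u hu => isZero_killAt (hS u w hu hw)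
    exact ⟨fun _ _ _ => h.eq_of_tgt _ _⟩
  · have := epi_phi_of_isZero (isZero_phiCoker_sigma (fun u : S => F.at u.1) hw)
    have h₂ := (genMap_exact F S).map_of_epi_of_preservesCokernel (evalAt A w)
      (inferInstanceAs (Epi (killπ F S))) inferInstance
    let R₁ := ComposableArrows.mk₂ ((phiSource A w).map (genMap F S))
      ((phiSource A w).map (killπ F S))
    let R₂ := ComposableArrows.mk₂ ((evalAt A w).map (genMap F S))
      ((evalAt A w).map (killπ F S))
    let φ : R₁ ⟶ R₂ := ComposableArrows.homMk₂ (phi _ w) (phi _ w) (phi _ w)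
      (phi_naturality _ w) (phi_naturality _ w)
    refine Abelian.mono_of_epi_of_epi_mono' φ ?_ ?_ h₂.exact_toComposableArrows this hF
    · exact ((phiSource A w).map_comp _ _).symm.trans
        ((congrArg _ (genMap_killπ F S)).trans ((phiSource A w).map_zero _ _))
    · exact inferInstanceAs (Epi ((phiSource A w).map (killπ F S)))

lemma isIso_phiCoker_map_killπ {F : Rep Q A} {S : Set Q} {w : Q} (hw : w ∉ S) :
    IsIso ((phiCoker A w).map (killπ F S)) := by
  have h := (genMap_exact F S).map_of_epi_of_preservesCokernel (phiCoker A w)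
    (inferInstanceAs (Epi (killπ F S))) inferInstance
  have : Mono ((phiCoker A w).map (killπ F S)) :=
    h.mono_g ((isZero_phiCoker_sigma (fun u : S => F.at u.1) hw).eq_of_src _ _)
  exact isIso_of_mono_of_epi _

lemma isIso_phiπ_killAt {F : Rep Q A} {S : Set Q} {w : Q}
    (hpre : ∀ u : Q, Nonempty (u ⟶ w) → u ∈ S) : IsIso (phiπ (killAt F S) w) :=
  isIso_phiπ _ _ ((isZero_phiSource fun u hu => isZero_killAt (hpre u hu)).eq_of_src _ _)

variable [AB4OfSize.{v} A]

/-- Monicity is checked on cokernels: at `w` the value of `killAt F S` is its own cokernel, and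
elsewhere the free representation has cokernel zero. -/
lemma mono_freeDesc_killAt (hQ : IsLeftRooted Q) {F : Rep Q A} (hF : ∀ w, Mono (phi F w))
    {S : Set Q} (hS : ∀ u w : Q, Nonempty (u ⟶ w) → w ∈ S → u ∈ S) {w : Q}
    (hpre : ∀ u : Q, Nonempty (u ⟶ w) → u ∈ S) :
    Mono (freeDesc (𝟙 ((killAt F S).at w))) := by
  refine mono_of_mono_phiCoker_map hQ _ (fun _ => inferInstance)
    (fun u => mono_phi_killAt hS u) fun u => ?_
  by_cases hu : w = u
  · subst hu
    have := isIso_phiπ_killAt (F := F) hpre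
    have h := phiCokerFreeRepIso_inv_map (𝟙 ((killAt F S).at w))
    rw [Category.id_comp, Iso.inv_comp_eq] at h
    rw [h]
    infer_instance
  · exact ⟨fun _ _ _ => (isZero_phiCoker_freeRep hu _).eq_of_tgt _ _⟩

/-- Dividing `killAt F S` by the free subrepresentation on its value at `w` kills `insert w S`, so
`x` dies there and lands in that subrepresentation. -/
lemma exists_lift_of_comp_killπ_insert (hQ : IsLeftRooted Q) {F : Rep Q A}
    (hF : ∀ w, Mono (phi F w))
    {S : Set Q} (hS : ∀ u w : Q, Nonempty (u ⟶ w) → w ∈ S → u ∈ S) {w : Q}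
    (hpre : ∀ u : Q, Nonempty (u ⟶ w) → u ∈ S) {M : Rep Q A} {x : M ⟶ F}
    (hx : x ≫ killπ F (insert w S) = 0) :
    ∃ y : M ⟶ freeRep w ((killAt F S).at w), y ≫ freeDesc (𝟙 _) = x ≫ killπ F S := by
  have := mono_freeDesc_killAt hQ hF hS hpre
  let β : freeRep w ((killAt F S).at w) ⟶ killAt F S := freeDesc (𝟙 _)
  have hβ : (cokernel.π β).app ((Paths.of Q).obj w) = 0 := by
    have h : freeι w _ .nil ≫ (β ≫ cokernel.π β).app ((Paths.of Q).obj w) = 0 := by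
      rw [cokernel.condition]
      exact comp_zero
    rwa [NatTrans.comp_app, freeι_nil_freeDesc_assoc, Category.id_comp] at h
  have hz : ∀ u ∈ insert w S, (killπ F S ≫ cokernel.π β).app ((Paths.of Q).obj u) = 0 := by
    intro u hu
    rw [NatTrans.comp_app]
    obtain rfl | hu := hu
    · rw [hβ, comp_zero]
    · rw [killπ_app hu, zero_comp]
  have h₀ : (x ≫ killπ F S) ≫ cokernel.π β = 0 := by
    rw [Category.assoc, ← killπ_killDesc _ hz, ← Category.assoc, hx, zero_comp]
  exact ⟨(ShortComplex.exact_cokernel β).lift _ h₀, ShortComplex.Exact.lift_f _ _ _⟩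

end Closed

section Factorization

variable [AB4OfSize.{v} A]

lemma exists_factorization (hQ : IsLeftRooted Q) {F : Rep Q A}
    (hF : Phi Q (ObjectProperty.ind.{v} (fgProj A)) F) {M : Rep Q A}
    [IsFinitelyPresentable.{v} M] (x : M ⟶ F) :
    ∃ (W : Rep Q A) (a : M ⟶ W) (b : W ⟶ F), a ≫ b = x ∧ fgProj (Rep Q A) W := by
  have hmono (w : Q) : Mono (phi F w) := (Phi_iff.1 hF w).1
  -- Zorn's lemma is applied to the predecessor-closed sets `S` for which every `x` killed by `killπ
  -- F S` factors.
  let good : Set (Set Q) := {S | (∀ u w : Q, Nonempty (u ⟶ w) → w ∈ S → u ∈ S) ∧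
    ∀ x : M ⟶ F, x ≫ killπ F S = 0 →
      ∃ (W : Rep Q A) (a : M ⟶ W) (b : W ⟶ F), a ≫ b = x ∧ fgProj (Rep Q A) W}
  have hempty : ∅ ∈ good := by
    refine ⟨by simp, fun x hx => ⟨0, 0, 0, ?_, fgProj_isZero (isZero_zero _)⟩⟩
    rw [eq_zero_of_comp_killπ_empty hx, zero_comp]
  obtain ⟨S, -, hS⟩ := zorn_subset_nonempty good (fun c hc hchain hne => by
    refine ⟨⋃₀ c, ⟨fun u w h ⟨S, hS, hw⟩ => ⟨S, hS, (hc hS).1 u w h hw⟩, fun x hx => ?_⟩,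
      fun S hS => Set.subset_sUnion_of_mem hS⟩
    obtain ⟨S, hS, hx⟩ := exists_comp_killπ_eq_zero hchain hne hx
    exact (hc hS).2 x hx) ∅ hempty
  obtain ⟨hcl, hgood⟩ := hS.prop
  suffices S = Set.univ by
    subst this
    exact hgood x (comp_killπ_univ x)
  by_contra hne
  obtain ⟨w, hw, hmin⟩ := hQ.wellFounded.has_min Sᶜ (by rwa [Set.nonempty_compl])
  have hpre (u : Q) (hu : Nonempty (u ⟶ w)) : u ∈ S := by
    by_contra h
    exact hmin u h hu
  refine hw (hS.le_of_ge (y := insert w S) ⟨?_, fun x hx => ?_⟩ (Set.subset_insert w S)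
    (Set.mem_insert w S))
  · rintro u u' h (rfl | hu')
    · exact Or.inr (hpre u h)
    · exact Or.inr (hcl u u' h hu')
  · obtain ⟨y, hy⟩ := exists_lift_of_comp_killπ_insert hQ hmono hcl hpre hx
    -- All predecessors of `w` lie in `S` and `w` does not, so this value is the cokernel of `phi F
    -- w`.
    have hind : ObjectProperty.ind.{v} (fgProj A) ((killAt F S).at w) := by
      have h := (Phi_iff.1 hF w).2
      rw [ObjectProperty.isoClosure_eq_self] at h
      have := isIso_phiCoker_map_killπ (F := F) hw
      have := isIso_phiπ_killAt (F := F) hpre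
      exact ObjectProperty.prop_of_iso _
        (asIso ((phiCoker A w).map (killπ F S)) ≪≫ (asIso (phiπ (killAt F S) w)).symm) h
    obtain ⟨P, z, t, rfl, hP⟩ := exists_factorization_freeRep hind y
    have hP' := fgProj_freeRep w hP
    have := hP'.2
    -- Correcting `x` by `z ≫ l` makes it vanish in `killAt F S`, where the maximal set already
    -- gives a factorization.
    let l : freeRep w P ⟶ F := Projective.factorThru (t ≫ freeDesc (𝟙 _)) (killπ F S)
    have hl : l ≫ killπ F S = t ≫ freeDesc (𝟙 _) := Projective.factorThru_comp _ _
    obtain ⟨W, a, b, hab, hW⟩ := hgood (x - z ≫ l) (by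
      rw [Preadditive.sub_comp, Category.assoc, hl, ← hy, Category.assoc, sub_self])
    refine ⟨freeRep w P ⊞ W, biprod.lift z a, biprod.desc l b, ?_, fgProj_biprod hP' hW⟩
    rw [biprod.lift_desc, hab, add_sub_cancel]

end Factorization

end KillAt

/-! ### Statement 4 and the main theorem -/

section Main

variable {Q : Type v} [Quiver.{v} Q] {A : Type u} [Category.{v} A] [Abelian A] [HasColimits A]
  [AB5 A]

theorem Phi_ind_fgProj_eq (hQ : IsLeftRooted Q) (hA : IsLocallyFinitelyPresentable.{v} A)
    (hs : (fgProj A).IsSeparating) :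
    Phi Q (ObjectProperty.ind.{v} (fgProj A)) =
      ObjectProperty.ind.{v} (fgProj (Rep Q A)) := by
  have := Abelian.hasFiniteBiproducts (C := A)
  have : AB4OfSize.{v} A := AB4.of_AB5 A
  have : IsLocallyFinitelyPresentable.{v} (Rep Q A) := isLocallyFinitelyPresentable_rep hA hs
  obtain ⟨I, p, hp, hsep⟩ := exists_small_fgProj hA hs
  have := enoughProjectives_of_isSeparating (fun i => (hp i).2) hsep
  refine le_antisymm (fun F hF => ?_) (ind_fgProj_le_Phi hQ)
  -- Lazard's criterion, available because `Rep Q A` is locally finitely presentable.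
  exact (ObjectProperty.ind_iff_exists fgProj_le_isFinitelyPresentable).2
    fun x _ => exists_factorization hQ hF x

end Main

end QuiverRep

theorem mainTheorem8 {A : Type u} [Category.{v} A] [Abelian A] [HasColimits A] [AB5 A]
    (Q : Type v) [Quiver.{v} Q] (hQ : QuiverRep.IsLeftRooted Q) :
    (∀ X : ObjectProperty A, (∀ x : A, X x → Projective x) →
      (QuiverRep.Phi Q (QuiverRep.sums X) = QuiverRep.sums (QuiverRep.freeReps Q X) ∧
        QuiverRep.sums (QuiverRep.Phi Q X) ≤ QuiverRep.Phi Q (QuiverRep.sums X) ∧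
        (X.ContainsZero →
          QuiverRep.Phi Q (QuiverRep.sums X) = QuiverRep.sums (QuiverRep.Phi Q X))) ∧
      (QuiverRep.Phi Q (QuiverRep.addClosure X) =
          QuiverRep.addClosure (QuiverRep.freeReps Q X) ∧
        QuiverRep.Phi Q (QuiverRep.addClosure X) =
          QuiverRep.addClosure (QuiverRep.Phi Q X))) ∧
    (EnoughProjectives A →
      QuiverRep.Phi Q (isProjective A) =
        isProjective (QuiverRep.Rep Q A)) ∧
    (IsLocallyFinitelyPresentable.{v} A →
      (QuiverRep.fgProj A).IsSeparating →
      QuiverRep.Phi Q (ObjectProperty.ind.{v} (QuiverRep.fgProj A)) =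
        ObjectProperty.ind.{v} (QuiverRep.fgProj (QuiverRep.Rep Q A))) := by
  have := Abelian.hasFiniteBiproducts (C := A)
  have : AB4OfSize.{v} A := AB4.of_AB5 A
  exact ⟨fun X hX => ⟨⟨QuiverRep.Phi_sums_eq hQ hX, QuiverRep.sums_Phi_le X,
    fun _ => QuiverRep.Phi_sums_eq_of_containsZero hQ hX⟩, QuiverRep.Phi_addClosure_eq hQ hX⟩,
    fun _ => QuiverRep.Phi_isProjective_eq hQ, QuiverRep.Phi_ind_fgProj_eq hQ⟩
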